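/- Fix an integer $k\ge 0$. Let $\mathcal L$ be the set of lines of slope $0$, $-1$ and $\infty$ through points of $\mathbb Z^2$, each cut into segments between consecutive integral points. To an oriented curve $\gamma$ in $\mathbb R^2$ associate the poset $\mathcal P_\gamma$ with elements $(\tau,0),\dots,(\tau,k)$ for each crossing of $\gamma$ with a segment $\tau$ of $\mathcal L$, generated by the following relations. If the crossing point lies strictly closer to the endpoint of $\tau$ to the right of $\gamma$, then $(\tau,0)\succ(\tau,1)\succ\cdots\succ(\tau,k)$; otherwise $(\tau,0)\prec(\tau,1)\prec\cdots\prec(\tau,k)$. If $\gamma$ crosses $\tau$ and $\tau'$ consecutively in this order, then $(\tau,k)\succ(\tau',0)$ if their common endpoint is to the right of $\gamma$, and $(\tau,k)\prec(\tau',0)$ if it is to the left of $\gamma$. For $(p,q)\in\mathbb Z^2\setminus\{(0,0)\}$ let $\gamma^L_{(p,q)}$ be the straight line segment from $(0,0)$ to $(p,q)$, deformed slightly with its endpoints fixed so that it passes to the left of every point of $(\tfrac12\mathbb Z)^2$ in its interior, and let $m^{(k)}_{(p,q)}$ be the number of order ideals (downwards closed subsets, including the empty one) of $\mathcal P_{\gamma^L_{(p,q)}}$.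 Then for all $n\ge 1$, \[ m^{(k)}_{(n,1)}=(k+1)\,m^{(k)}_{(n,0)}+m^{(k)}_{(n-1,1)} \qquad\text{and}\qquad m^{(k)}_{(n+1,n)}=2(k+1)\,m^{(k)}_{(n,n)}+m^{(k)}_{(n,n-1)}. \] -/

import Mathlib

open scoped Topology

/-- An integral point, viewed in the real plane. -/
def latticePoint (a : ℤ × ℤ) : ℝ × ℝ := ((a.1 : ℝ), (a.2 : ℝ))

/-- Two integral points are the endpoints of a segment of the lattice `𝓛` (the lines of slope
`0`, `-1` and `∞` through integral points, cut into segments between consecutive integral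
points). -/
def LatticeAdj (a b : ℤ × ℤ) : Prop :=
  b - a = (1, 0) ∨ b - a = (-1, 0) ∨ b - a = (0, 1) ∨ b - a = (0, -1) ∨
    b - a = (1, -1) ∨ b - a = (-1, 1)

/-- `det (l - r, x - r)`: positive if `x` lies to the left of the line directed from `r` to `l`,
negative if `x` lies to its right. -/
def sideOf (l r : ℤ × ℤ) (x : ℝ × ℝ) : ℝ :=
  ((l.1 : ℝ) - r.1) * (x.2 - r.2) - ((l.2 : ℝ) - r.2) * (x.1 - r.1)

/-- An intersection of the oriented curve `γ` (parametrized by `[0, 1]`) with a segment of `𝓛`: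
at the given time the curve passes through the relative interior of the segment, from one side to
the other, the endpoint `left` being to the left of `γ` and the endpoint `right` to its right. -/
structure Crossing (γ : ℝ → ℝ × ℝ) where
  time : ℝ
  left : ℤ × ℤ
  right : ℤ × ℤ
  time_mem : time ∈ Set.Ioo (0 : ℝ) 1
  adj : LatticeAdj left right
  mem_segment : γ time ∈ openSegment ℝ (latticePoint left) (latticePoint right)
  before : ∀ᶠ s in 𝓝[<] time, 0 < sideOf left right (γ s)
  after : ∀ᶠ s in 𝓝[>] time, sideOf left right (γ s) < 0

namespace Crossing

variable {γ : ℝ → ℝ × ℝ}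

/-- The intersection point lies strictly closer to the right endpoint of the segment. (The point
is on the segment, so all norms on the plane give the same comparison.) -/
def CloserToRight (c : Crossing γ) : Prop :=
  dist (γ c.time) (latticePoint c.right) < dist (γ c.time) (latticePoint c.left)

/-- `γ` crosses the segments of `c` and `c'` consecutively, in this order. -/
def Consecutive (c c' : Crossing γ) : Prop :=
  c.time < c'.time ∧ ∀ d : Crossing γ, ¬ (c.time < d.time ∧ d.time < c'.time)

end Crossing

/-- The underlying set of the poset `𝓟_γ`: a chain of `k + 1` elements for every intersection
of `γ` with a segment of `𝓛`. -/
def CurvePoset (k : ℕ) (γ : ℝ → ℝ × ℝ) : Type := Crossing γ × Fin (k + 1)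

/-- The relations that define `𝓟_γ`; `CurvePoset.Step k γ x y` says `x ≺ y`. -/
inductive CurvePoset.Step (k : ℕ) (γ : ℝ → ℝ × ℝ) : CurvePoset k γ → CurvePoset k γ → Prop
  /-- `(τ, 0) ≻ (τ, 1) ≻ ⋯ ≻ (τ, k)` -/
  | chain_right (c : Crossing γ) (h : c.CloserToRight) (i : Fin k) :
      CurvePoset.Step k γ (c, i.succ) (c, i.castSucc)
  /-- `(τ, 0) ≺ (τ, 1) ≺ ⋯ ≺ (τ, k)` -/
  | chain_left (c : Crossing γ) (h : ¬ c.CloserToRight) (i : Fin k) :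
      CurvePoset.Step k γ (c, i.castSucc) (c, i.succ)
  /-- `(τ, k) ≻ (τ', 0)` if the common endpoint of `τ` and `τ'` is to the right of `γ` -/
  | link_right (c c' : Crossing γ) (h : c.Consecutive c') (hr : c.right = c'.right) :
      CurvePoset.Step k γ (c', 0) (c, Fin.last k)
  /-- `(τ, k) ≺ (τ', 0)` if the common endpoint of `τ` and `τ'` is to the left of `γ` -/
  | link_left (c c' : Crossing γ) (h : c.Consecutive c') (hl : c.left = c'.left) :
      CurvePoset.Step k γ (c, Fin.last k) (c', 0)

/-- The order of `𝓟_γ`: the reflexive and transitive closure of the defining relations. -/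
instance (k : ℕ) (γ : ℝ → ℝ × ℝ) : Preorder (CurvePoset k γ) where
  le := Relation.ReflTransGen (CurvePoset.Step k γ)
  le_refl _ := Relation.ReflTransGen.refl
  le_trans _ _ _ := Relation.ReflTransGen.trans

/-- The curve `γ^L_{(p,q)}`: the line segment from `(0, 0)` to `(p, q)`, pushed slightly to the
left of its direction (the vector `(-q, p)` points to the left), with its endpoints fixed.
It is at distance at most `1 / (16 √(p² + q²))` from the line segment, whereas a point of
`(½ℤ)²` off the line through `(0, 0)` and `(p, q)` is at distance at least `1 / (2 √(p² + q²))`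
from that line. So the points of `(½ℤ)²` inside the line segment come to lie to the right of the
curve, and no other point of `(½ℤ)²` changes sides. -/
noncomputable def leftCurve (p q : ℤ) (t : ℝ) : ℝ × ℝ :=
  (t * p - t * (1 - t) / (4 * ((p : ℝ) ^ 2 + (q : ℝ) ^ 2)) * q,
   t * q + t * (1 - t) / (4 * ((p : ℝ) ^ 2 + (q : ℝ) ^ 2)) * p)

/-- `m^{(k)}_{(p,q)}`: the number of order ideals (downwards closed subsets) of the poset
`𝓟_{(p,q)}` of the curve `γ^L_{(p,q)}`. -/
noncomputable def kMarkov (k : ℕ) (p q : ℤ) : ℕ :=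
  Nat.card (LowerSet (CurvePoset k (leftCurve p q)))

/-! Each poset here is a fence: a path in which every edge points up or down. Its ideals are counted
by a transfer vector (ideals avoiding, ideals containing the last element), and one more edge acts
by one of the two elementary unipotent matrices, `fenceStep`.

Geometry supplies the edges. With `height` the determinant against `(p, q)`, the height of the curve
stays in `(0, 1/4)`, whereas integral points have integral height. Hence the crossed segments, their
order, the common endpoints of neighbours and the nearer endpoints all reduce to integer
inequalities (`kMarkov_eq_chainVec`). The remaining geometric work is to list the crossings for `(n,
0)`, `(n, 1)`, `(n, n)` and `(n + 1, n)`.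

For `(n, 1)` and `(n + 1, n)` the point reflection in the midpoint of the line segment reverses the
order of the crossings and exchanges left and right, except at the middle crossing, where the push
to the left breaks the tie. The two elementary matrices are transposes of each other, so both halves
of the fence, read inwards, give the same vector `(a, b)`, and the count is the quadratic form `a² +
kab + b²` (`total_eq_halfForm`).

Passing from `n - 1` to `n` lengthens the half fence by one chain for `(n, 1)`, by two for `(n + 1,
n)`. The growth of the form is then `k + 1`, respectively `2(k + 1)`, times a bilinear expression in
the half vectors. The addition formulas `rowVec_add` and `diagVec_add` identify that expression as
the count for `(n, 0)`, respectively `(n, n)`. -/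

/-! ### Counting ideals of fences by transfer vectors -/

/-- Effect of one more element of a fence on the numbers of ideals that avoid, respectively
contain, its last element; `d = true` means that the new element is below the last one. -/
def fenceStep (d : Bool) (x : ℕ × ℕ) : ℕ × ℕ :=
  bif d then (x.1, x.1 + x.2) else (x.1 + x.2, x.2)

/-- The numbers of ideals of the fence on `0, …, m` that avoid, respectively contain, `m`. -/
def fenceVec (e : ℕ → Bool) : ℕ → ℕ × ℕ
  | 0 => (1, 1)
  | m + 1 => fenceStep (e m) (fenceVec e m)

/-- `T` is downwards closed in the fence on `0, …, M` in which `m + 1 ≺ m` if `e m`, and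
`m ≺ m + 1` otherwise. -/
def IsFenceIdeal (e : ℕ → Bool) (M : ℕ) (T : Finset ℕ) : Prop :=
  ∀ m < M, (e m = true → m ∈ T → m + 1 ∈ T) ∧ (e m = false → m + 1 ∈ T → m ∈ T)

theorem isFenceIdeal_succ (e : ℕ → Bool) (M : ℕ) (T : Finset ℕ) :
    IsFenceIdeal e (M + 1) T ↔ IsFenceIdeal e M T ∧
      ((e M = true → M ∈ T → M + 1 ∈ T) ∧ (e M = false → M + 1 ∈ T → M ∈ T)) := by
  unfold IsFenceIdeal
  constructor
  · intro h
    exact ⟨fun m hm => h m (by omega), h M (by omega)⟩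
  · rintro ⟨h, h'⟩ m hm
    rcases Nat.lt_succ_iff_lt_or_eq.1 hm with hm | rfl
    · exact h m hm
    · exact h'

theorem isFenceIdeal_insert (e : ℕ → Bool) (M : ℕ) (T : Finset ℕ) :
    IsFenceIdeal e M (insert (M + 1) T) ↔ IsFenceIdeal e M T := by
  unfold IsFenceIdeal
  refine forall₂_congr fun m hm => ?_
  have h1 : m ≠ M + 1 := by omega
  have h2 : m + 1 ≠ M + 1 := by omega
  simp only [Finset.mem_insert, h1, h2, false_or]

open Classical in
/-- The ideals of the fence on `0, …, M`. -/
noncomputable def fenceIdeals (e : ℕ → Bool) (M : ℕ) : Finset (Finset ℕ) :=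
  (Finset.range (M + 1)).powerset.filter (IsFenceIdeal e M)

theorem mem_fenceIdeals {e : ℕ → Bool} {M : ℕ} {T : Finset ℕ} :
    T ∈ fenceIdeals e M ↔ T ⊆ Finset.range (M + 1) ∧ IsFenceIdeal e M T := by
  simp [fenceIdeals]

/-- Induction on the last element: if it lies below its predecessor, it can be left out only when
the predecessor is; if it lies above, it can be put in only when the predecessor is. In the other
case any ideal of the shorter fence extends. -/
theorem card_fenceIdeals_split (e : ℕ → Bool) (M : ℕ) :
    ((fenceIdeals e M).filter (M ∉ ·)).card = (fenceVec e M).1 ∧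
      ((fenceIdeals e M).filter (M ∈ ·)).card = (fenceVec e M).2 := by
  have total : ∀ M, ((fenceIdeals e M).filter (M ∉ ·)).card +
      ((fenceIdeals e M).filter (M ∈ ·)).card = (fenceIdeals e M).card := fun M => by
    rw [add_comm]; exact Finset.card_filter_add_card_filter_not _
  induction M with
  | zero =>
    have h0 : (fenceIdeals e 0).filter (0 ∉ ·) = {∅} := by
      ext T
      simp only [Finset.mem_filter, mem_fenceIdeals, Finset.mem_singleton]
      constructor
      · rintro ⟨⟨h, -⟩, h'⟩
        simp [Finset.subset_singleton_iff] at h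
        rcases h with h | h
        · exact h
        · simp [h] at h'
      · rintro rfl
        simp [IsFenceIdeal]
    have h1 : (fenceIdeals e 0).filter (0 ∈ ·) = {{0}} := by
      ext T
      simp only [Finset.mem_filter, mem_fenceIdeals, Finset.mem_singleton]
      constructor
      · rintro ⟨⟨h, -⟩, h'⟩
        simp [Finset.subset_singleton_iff] at h
        rcases h with h | h
        · simp [h] at h'
        · exact h
      · rintro rfl
        simp [IsFenceIdeal]
    simp [h0, h1, fenceVec]
  | succ M ih =>
    have hsub : ∀ T : Finset ℕ, M + 1 ∉ T →
        (T ⊆ Finset.range (M + 1 + 1) ↔ T ⊆ Finset.range (M + 1)) := by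
      intro T hT
      rw [Finset.range_add_one (n := M + 1), Finset.subset_insert_iff_of_notMem hT]
    have hnot : ∀ T ∈ fenceIdeals e M, M + 1 ∉ T := by
      intro T hT h
      have := (mem_fenceIdeals.1 hT).1 h
      simp at this
    have h0 : (fenceIdeals e (M + 1)).filter (M + 1 ∉ ·) =
        bif e M then (fenceIdeals e M).filter (M ∉ ·) else fenceIdeals e M := by
      ext T
      simp only [Finset.mem_filter, mem_fenceIdeals, isFenceIdeal_succ]
      by_cases hT : M + 1 ∈ T
      · have : T ∉ fenceIdeals e M := fun h => hnot T h hT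
        cases e M <;> simp [hT, this]
      · cases h : e M <;> simp [hT, hsub, mem_fenceIdeals, and_assoc]
    have h1 : (fenceIdeals e (M + 1)).filter (M + 1 ∈ ·) =
        (bif e M then fenceIdeals e M else (fenceIdeals e M).filter (M ∈ ·)).image
          (insert (M + 1)) := by
      ext T
      simp only [Finset.mem_filter, mem_fenceIdeals, isFenceIdeal_succ, Finset.mem_image]
      constructor
      · rintro ⟨⟨hr, hi, hd⟩, hT⟩
        refine ⟨T.erase (M + 1), ?_, Finset.insert_erase hT⟩
        have hi' : IsFenceIdeal e M (T.erase (M + 1)) := by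
          rwa [← isFenceIdeal_insert, Finset.insert_erase hT]
        have hr' : T.erase (M + 1) ⊆ Finset.range (M + 1) := by
          rwa [← hsub _ (Finset.notMem_erase _ _), ← Finset.insert_subset_insert_iff
            (Finset.notMem_erase (M + 1) T), Finset.insert_erase hT,
            Finset.insert_eq_of_mem (by simp)]
        cases h : e M
        · simp [mem_fenceIdeals, hi', hr', hd.2 h hT]
        · simp [mem_fenceIdeals, hi', hr']
      · rintro ⟨T', hT', rfl⟩
        have hmem : T' ∈ fenceIdeals e M := by
          revert hT'
          cases e M <;> simp +contextual
        obtain ⟨hr, hi⟩ := mem_fenceIdeals.1 hmem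
        refine ⟨⟨Finset.insert_subset (by simp)
          ((hsub T' (hnot T' hmem)).2 hr), (isFenceIdeal_insert _ _ _).2 hi, ?_, ?_⟩, by simp⟩
        · simp
        · intro h _
          rw [h] at hT'
          exact Finset.mem_insert_of_mem (Finset.mem_filter.1 hT').2
    have hcard : ∀ F ⊆ fenceIdeals e M, (F.image (insert (M + 1))).card = F.card := by
      intro F hF
      refine Finset.card_image_of_injOn fun T hT T' hT' h => ?_
      rw [← Finset.erase_insert (hnot T (hF hT)), ← Finset.erase_insert (hnot T' (hF hT'))]
      exact congrArg (Finset.erase · (M + 1)) h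
    rw [h0, h1, hcard _ (by cases e M <;> simp)]
    have := total M
    cases h : e M <;> simp only [cond_true, cond_false, fenceVec, fenceStep, h] <;> omega

theorem card_fenceIdeals (e : ℕ → Bool) (M : ℕ) :
    (fenceIdeals e M).card = (fenceVec e M).1 + (fenceVec e M).2 := by
  rw [← (card_fenceIdeals_split e M).1, ← (card_fenceIdeals_split e M).2, add_comm]
  exact (Finset.card_filter_add_card_filter_not _).symm

/-! ### Fences made of chains of `k + 1` elements -/

/-- The vector of the fence that consists of chains of `k + 1` elements, the `i`-th one having
direction `r i` and being linked to the next one in direction `s i`, after the first element of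
the `i`-th chain. -/
def chainVec (k : ℕ) (r s : ℕ → Bool) : ℕ → ℕ × ℕ
  | 0 => (1, 1)
  | i + 1 => fenceStep (s i) ((fenceStep (r i))^[k] (chainVec k r s i))

/-- The direction of the `m`-th link in the fence of `chainVec`. -/
def chainDir (k : ℕ) (r s : ℕ → Bool) (m : ℕ) : Bool :=
  if m % (k + 1) = k then s (m / (k + 1)) else r (m / (k + 1))

theorem mul_add_div_mod (k i j : ℕ) (hj : j ≤ k) :
    (i * (k + 1) + j) / (k + 1) = i ∧ (i * (k + 1) + j) % (k + 1) = j := by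
  constructor
  · rw [mul_comm, Nat.mul_add_div (by omega), Nat.div_eq_of_lt (by omega), add_zero]
  · rw [mul_comm, Nat.mul_add_mod, Nat.mod_eq_of_lt (by omega)]

theorem fenceVec_chainDir (k : ℕ) (r s : ℕ → Bool) (i : ℕ) : ∀ j ≤ k,
    fenceVec (chainDir k r s) (i * (k + 1) + j) = (fenceStep (r i))^[j] (chainVec k r s i) := by
  induction i with
  | zero =>
    intro j
    induction j with
    | zero => intro _; simp [fenceVec, chainVec]
    | succ j ih =>
      intro hj
      obtain ⟨h1, h2⟩ := mul_add_div_mod k 0 j (by omega)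
      rw [← add_assoc, fenceVec, ih (by omega), chainDir, h1, h2, if_neg (by omega),
        Function.iterate_succ_apply']
  | succ i hi =>
    intro j
    induction j with
    | zero =>
      intro _
      obtain ⟨h1, h2⟩ := mul_add_div_mod k i k le_rfl
      have : (i + 1) * (k + 1) + 0 = i * (k + 1) + k + 1 := by ring
      rw [this, fenceVec, hi k le_rfl, chainDir, h1, h2, if_pos rfl]
      rfl
    | succ j ih =>
      intro hj
      obtain ⟨h1, h2⟩ := mul_add_div_mod k (i + 1) j (by omega)
      rw [← add_assoc, fenceVec, ih (by omega), chainDir, h1, h2, if_neg (by omega),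
        Function.iterate_succ_apply']

/-! ### The poset of a curve with finitely many ordered crossings is a fence -/

variable {γ : ℝ → ℝ × ℝ}

theorem isLowerSet_curvePoset_iff (k : ℕ) (S : Set (CurvePoset k γ)) :
    IsLowerSet S ↔ ∀ x y, CurvePoset.Step k γ x y → y ∈ S → x ∈ S := by
  constructor
  · intro h x y hxy hy
    exact h (Relation.ReflTransGen.single hxy : x ≤ y) hy
  · intro h y x hxy
    have hxy' : Relation.ReflTransGen (CurvePoset.Step k γ) x y := hxy
    induction hxy' with
    | refl => exact id
    | tail hxz hzy ih => exact fun hy => ih hxz (h _ _ hzy hy)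

/-- The `m`-th element of `𝓟_γ` along the curve. -/
def curvePoint (k : ℕ) (c : ℕ → Crossing γ) (m : ℕ) : CurvePoset k γ :=
  (c (m / (k + 1)), ⟨m % (k + 1), Nat.mod_lt _ (by omega)⟩)

theorem curvePoint_mul_add (k : ℕ) (c : ℕ → Crossing γ) (i j : ℕ) (hj : j < k + 1) :
    curvePoint k c (i * (k + 1) + j) = (c i, ⟨j, hj⟩) := by
  obtain ⟨h1, h2⟩ := mul_add_div_mod k i j (by omega)
  exact Prod.ext (congrArg c h1) (Fin.ext h2)

/-- `c 0, …, c N` are all crossings of the curve in their order, `r i` tells whether `c i` is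
closer to its right endpoint, and `s i` whether `c i` and `c (i + 1)` share their right or their
left endpoint. -/
structure CrossingSequence (N : ℕ) (c : ℕ → Crossing γ) (r s : ℕ → Bool) : Prop where
  time_lt : ∀ i < N, (c i).time < (c (i + 1)).time
  surj : ∀ d, ∃ i ≤ N, c i = d
  closer : ∀ i ≤ N, (c i).CloserToRight ↔ r i = true
  right_eq : ∀ i < N, (c i).right = (c (i + 1)).right ↔ s i = true
  left_eq : ∀ i < N, (c i).left = (c (i + 1)).left ↔ s i = false

namespace CrossingSequence

variable {N : ℕ} {c : ℕ → Crossing γ} {r s : ℕ → Bool}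

theorem time_lt_iff (h : CrossingSequence N c r s) {i j : ℕ} (hi : i ≤ N) (hj : j ≤ N) :
    (c i).time < (c j).time ↔ i < j := by
  have key : ∀ i j, i < j → j ≤ N → (c i).time < (c j).time := by
    intro i j hij
    induction j, hij using Nat.le_induction with
    | base => exact fun hN => h.time_lt i (by omega)
    | succ j _ ih => exact fun hN => (ih (by omega)).trans (h.time_lt j (by omega))
  refine ⟨fun hlt => ?_, fun hij => key i j hij hj⟩
  by_contra hij
  rcases (not_lt.1 hij).eq_or_lt with rfl | hji
  · exact lt_irrefl _ hlt
  · exact lt_asymm hlt (key j i hji hi)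

theorem injOn (h : CrossingSequence N c r s) {i j : ℕ} (hi : i ≤ N) (hj : j ≤ N)
    (hij : c i = c j) : i = j := by
  by_contra hne
  rcases Nat.lt_or_gt_of_ne hne with hlt | hlt
  · exact ((h.time_lt_iff hi hj).2 hlt).ne (by rw [hij])
  · exact ((h.time_lt_iff hj hi).2 hlt).ne (by rw [hij])

theorem consecutive_iff (h : CrossingSequence N c r s) {i j : ℕ} (hi : i ≤ N) (hj : j ≤ N) :
    (c i).Consecutive (c j) ↔ j = i + 1 := by
  unfold Crossing.Consecutive
  rw [h.time_lt_iff hi hj]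
  constructor
  · rintro ⟨hij, hd⟩
    by_contra hne
    refine hd (c (i + 1)) ?_
    rw [h.time_lt_iff hi (by omega), h.time_lt_iff (by omega) hj]
    omega
  · rintro rfl
    refine ⟨by omega, fun d => ?_⟩
    obtain ⟨l, hl, rfl⟩ := h.surj d
    rw [h.time_lt_iff hi hl, h.time_lt_iff hl hj]
    omega

/-- Write `m = i * (k + 1) + j`. For `j < k` the edge from `m` to `m + 1` lies inside the `i`-th
chain; for `j = k` it links that chain to the next one. -/
theorem step_iff (h : CrossingSequence N c r s) (k : ℕ) (x y : CurvePoset k γ) :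
    CurvePoset.Step k γ x y ↔ ∃ m < N * (k + 1) + k,
      (chainDir k r s m = true ∧ x = curvePoint k c (m + 1) ∧ y = curvePoint k c m) ∨
      (chainDir k r s m = false ∧ x = curvePoint k c m ∧ y = curvePoint k c (m + 1)) := by
  have hbound : ∀ {i j : ℕ}, i ≤ N → j < k → i * (k + 1) + j < N * (k + 1) + k := by
    intro i j hi hj
    have := Nat.mul_le_mul_right (k + 1) hi
    omega
  have hbound' : ∀ {i : ℕ}, i < N → i * (k + 1) + k < N * (k + 1) + k := by
    intro i hi
    have := Nat.mul_lt_mul_of_pos_right hi (Nat.succ_pos k)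
    simp only [Nat.succ_eq_add_one] at this
    omega
  have hnext : ∀ i, curvePoint k c (i * (k + 1) + k + 1) = (c (i + 1), 0) := by
    intro i
    have : i * (k + 1) + k + 1 = (i + 1) * (k + 1) + 0 := by ring
    rw [this, curvePoint_mul_add k c (i + 1) 0 (by omega)]
    rfl
  have hdir : ∀ i j, j < k → chainDir k r s (i * (k + 1) + j) = r i := by
    intro i j hj
    obtain ⟨h1, h2⟩ := mul_add_div_mod k i j (by omega)
    rw [chainDir, h1, h2, if_neg (by omega)]
  have hdir' : ∀ i, chainDir k r s (i * (k + 1) + k) = s i := by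
    intro i
    obtain ⟨h1, h2⟩ := mul_add_div_mod k i k le_rfl
    rw [chainDir, h1, h2, if_pos rfl]
  have hlast : ∀ i, curvePoint k c (i * (k + 1) + k) = (c i, Fin.last k) := fun i =>
    curvePoint_mul_add k c i k (by omega)
  constructor
  · intro hxy
    cases hxy with
    | chain_right d hd j =>
      obtain ⟨i, hi, rfl⟩ := h.surj d
      refine ⟨i * (k + 1) + j, hbound hi j.2, Or.inl ⟨?_, ?_, ?_⟩⟩
      · rw [hdir i j j.2]; exact (h.closer i hi).1 hd
      · rw [add_assoc, curvePoint_mul_add k c i (j + 1) (by omega)]; rfl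
      · rw [curvePoint_mul_add k c i j (by omega)]; rfl
    | chain_left d hd j =>
      obtain ⟨i, hi, rfl⟩ := h.surj d
      refine ⟨i * (k + 1) + j, hbound hi j.2, Or.inr ⟨?_, ?_, ?_⟩⟩
      · rw [hdir i j j.2]; rw [h.closer i hi] at hd; simpa using hd
      · rw [curvePoint_mul_add k c i j (by omega)]; rfl
      · rw [add_assoc, curvePoint_mul_add k c i (j + 1) (by omega)]; rfl
    | link_right d d' hd hr =>
      obtain ⟨i, hi, rfl⟩ := h.surj d
      obtain ⟨j, hj, rfl⟩ := h.surj d'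
      obtain rfl := (h.consecutive_iff hi hj).1 hd
      refine ⟨i * (k + 1) + k, hbound' (by omega), Or.inl ⟨?_, (hnext i).symm, (hlast i).symm⟩⟩
      rw [hdir']; exact (h.right_eq i (by omega)).1 hr
    | link_left d d' hd hl =>
      obtain ⟨i, hi, rfl⟩ := h.surj d
      obtain ⟨j, hj, rfl⟩ := h.surj d'
      obtain rfl := (h.consecutive_iff hi hj).1 hd
      refine ⟨i * (k + 1) + k, hbound' (by omega), Or.inr ⟨?_, (hlast i).symm, (hnext i).symm⟩⟩
      rw [hdir']; exact (h.left_eq i (by omega)).1 hl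
  · rintro ⟨m, hm, hxy⟩
    obtain ⟨i, j, hj, rfl⟩ : ∃ i j, j ≤ k ∧ m = i * (k + 1) + j :=
      ⟨m / (k + 1), m % (k + 1), Nat.lt_succ_iff.1 (Nat.mod_lt _ (by omega)),
        (Nat.div_add_mod' m (k + 1)).symm⟩
    have hi : i ≤ N := by
      by_contra hi
      have := Nat.mul_le_mul_right (k + 1) (show N + 1 ≤ i by omega)
      rw [Nat.add_mul] at this
      omega
    rcases hj.lt_or_eq with hj | rfl
    · rw [hdir i j hj, add_assoc, curvePoint_mul_add k c i (j + 1) (by omega),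
        curvePoint_mul_add k c i j (by omega)] at hxy
      rcases hxy with ⟨hr, rfl, rfl⟩ | ⟨hr, rfl, rfl⟩
      · exact CurvePoset.Step.chain_right (c i) ((h.closer i hi).2 hr) ⟨j, hj⟩
      · exact CurvePoset.Step.chain_left (c i) (by rw [h.closer i hi]; simpa using hr) ⟨j, hj⟩
    · have hi' : i < N := by
        refine lt_of_le_of_ne hi ?_
        rintro rfl
        omega
      rw [hdir', hnext, hlast] at hxy
      have hcons := (h.consecutive_iff hi (show i + 1 ≤ N from hi')).2 rfl
      rcases hxy with ⟨hr, rfl, rfl⟩ | ⟨hr, rfl, rfl⟩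
      · exact CurvePoset.Step.link_right _ _ hcons ((h.right_eq i hi').2 hr)
      · exact CurvePoset.Step.link_left _ _ hcons ((h.left_eq i hi').2 hr)

theorem curvePoint_injOn (h : CrossingSequence N c r s) (k : ℕ) {m m' : ℕ}
    (hm : m < (N + 1) * (k + 1)) (hm' : m' < (N + 1) * (k + 1))
    (heq : curvePoint k c m = curvePoint k c m') : m = m' := by
  unfold curvePoint at heq
  have h1 := congrArg Prod.fst heq
  have h2 := congrArg (fun z : Crossing γ × Fin (k + 1) => (z.2 : ℕ)) heq
  simp only at h1 h2
  have hd := h.injOn (Nat.lt_succ_iff.1 (Nat.div_lt_of_lt_mul (by rwa [mul_comm] at hm)))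
    (Nat.lt_succ_iff.1 (Nat.div_lt_of_lt_mul (by rwa [mul_comm] at hm'))) h1
  rw [← Nat.div_add_mod m (k + 1), hd, h2, Nat.div_add_mod]

theorem curvePoint_surj (h : CrossingSequence N c r s) (k : ℕ) (x : CurvePoset k γ) :
    ∃ m < (N + 1) * (k + 1), curvePoint k c m = x := by
  obtain ⟨d, j⟩ := x
  obtain ⟨i, hi, rfl⟩ := h.surj d
  refine ⟨i * (k + 1) + j, ?_, curvePoint_mul_add k c i j j.2⟩
  have := Nat.mul_le_mul_right (k + 1) hi
  rw [Nat.add_mul]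
  omega

-- Numbering the elements along the curve identifies the poset with the fence on `0, …, N(k + 1) +
-- k`, so ideals correspond by preimage and image under `curvePoint`.
open Classical in
theorem card_lowerSet (h : CrossingSequence N c r s) (k : ℕ) :
    Nat.card (LowerSet (CurvePoset k γ)) =
      ((fenceStep (r N))^[k] (chainVec k r s N)).1 +
        ((fenceStep (r N))^[k] (chainVec k r s N)).2 := by
  rw [← fenceVec_chainDir k r s N k le_rfl, ← card_fenceIdeals, ← Nat.card_eq_finsetCard]
  have hM : N * (k + 1) + k + 1 = (N + 1) * (k + 1) := by ring
  have hlower : ∀ S : Set (CurvePoset k γ), IsLowerSet S ↔ ∀ m < N * (k + 1) + k,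
      (chainDir k r s m = true → curvePoint k c m ∈ S → curvePoint k c (m + 1) ∈ S) ∧
      (chainDir k r s m = false → curvePoint k c (m + 1) ∈ S → curvePoint k c m ∈ S) := by
    intro S
    rw [isLowerSet_curvePoset_iff]
    constructor
    · intro hS m hm
      exact ⟨fun hd => hS _ _ ((h.step_iff k _ _).2 ⟨m, hm, Or.inl ⟨hd, rfl, rfl⟩⟩),
        fun hd => hS _ _ ((h.step_iff k _ _).2 ⟨m, hm, Or.inr ⟨hd, rfl, rfl⟩⟩)⟩
    · intro hS x y hxy
      obtain ⟨m, hm, ⟨hd, rfl, rfl⟩ | ⟨hd, rfl, rfl⟩⟩ := (h.step_iff k x y).1 hxy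
      · exact (hS m hm).1 hd
      · exact (hS m hm).2 hd
  refine Nat.card_eq_of_bijective (fun S => ⟨(Finset.range (N * (k + 1) + k + 1)).filter
    (fun m => curvePoint k c m ∈ S), mem_fenceIdeals.2 ⟨Finset.filter_subset _ _, ?_⟩⟩) ⟨?_, ?_⟩
  · intro m hm
    have := (hlower S).1 S.lower m hm
    simpa [Finset.mem_filter, show m < N * (k + 1) + k + 1 by omega, hm] using this
  · intro S S' hSS'
    have hSS := congrArg Subtype.val hSS'
    simp only at hSS
    apply LowerSet.ext
    ext x
    obtain ⟨m, hm, rfl⟩ := h.curvePoint_surj k x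
    have := Finset.ext_iff.1 hSS m
    simpa [Finset.mem_filter, hM, hm] using this
  · rintro ⟨T, hT⟩
    obtain ⟨hr, hi⟩ := mem_fenceIdeals.1 hT
    rw [hM] at hr
    have hmem : ∀ m < (N + 1) * (k + 1), curvePoint k c m ∈ curvePoint k c '' (T : Set ℕ) ↔
        m ∈ T := by
      intro m hm
      constructor
      · rintro ⟨m', hm', heq⟩
        rw [← h.curvePoint_injOn k (Finset.mem_range.1 (hr hm')) hm heq]
        exact hm'
      · exact fun hmT => ⟨m, hmT, rfl⟩
    refine ⟨⟨curvePoint k c '' (T : Set ℕ), (hlower _).2 fun m hm => ?_⟩, ?_⟩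
    · rw [hmem m (by omega), hmem (m + 1) (by omega)]
      exact hi m hm
    · apply Subtype.ext
      ext m
      simp only [Finset.mem_filter, Finset.mem_range, hM]
      constructor
      · rintro ⟨hm, hm'⟩
        exact (hmem m hm).1 hm'
      · intro hmT
        have hm := Finset.mem_range.1 (hr hmT)
        exact ⟨hm, (hmem m hm).2 hmT⟩

end CrossingSequence


/-! ### Geometry of the deformed line segment -/

/-- The determinant of `(p, q)` and an integral point; it is positive to the left of the line
through `(0, 0)` and `(p, q)`. -/
def height (p q : ℤ) (a : ℤ × ℤ) : ℤ := p * a.2 - q * a.1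

/-- `sideOf` for integral points. -/
def sideInt (l r x : ℤ × ℤ) : ℤ := (l.1 - r.1) * (x.2 - r.2) - (l.2 - r.2) * (x.1 - r.1)

theorem sideOf_latticePoint (l r x : ℤ × ℤ) :
    sideOf l r (latticePoint x) = (sideInt l r x : ℝ) := by
  simp [sideOf, latticePoint, sideInt]

theorem sideOf_swap (l r : ℤ × ℤ) (x : ℝ × ℝ) : sideOf r l x = -sideOf l r x := by
  simp only [sideOf]; ring

theorem LatticeAdj.symm {a b : ℤ × ℤ} (h : LatticeAdj a b) : LatticeAdj b a := by
  simp only [LatticeAdj, Prod.ext_iff, Prod.fst_sub, Prod.snd_sub] at h ⊢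
  omega

theorem LatticeAdj.abs_sub_le {a b : ℤ × ℤ} (h : LatticeAdj a b) :
    |a.1 - b.1| ≤ 1 ∧ |a.2 - b.2| ≤ 1 := by
  simp only [LatticeAdj, Prod.ext_iff, Prod.fst_sub, Prod.snd_sub] at h
  simp only [abs_le]
  omega

theorem exists_convex_of_mem_openSegment {l r : ℤ × ℤ} {x : ℝ × ℝ}
    (h : x ∈ openSegment ℝ (latticePoint l) (latticePoint r)) :
    ∃ a : ℝ, 0 < a ∧ a < 1 ∧ x.1 = a * l.1 + (1 - a) * r.1 ∧ x.2 = a * l.2 + (1 - a) * r.2 := by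
  obtain ⟨a, b, ha, hb, hab, rfl⟩ := h
  obtain rfl : b = 1 - a := by linarith
  exact ⟨a, ha, by linarith, by simp [latticePoint], by simp [latticePoint]⟩

section LeftCurve

variable {p q : ℤ}

theorem normSq_pos (hpq : (p, q) ≠ (0, 0)) : (0 : ℝ) < (p : ℝ) ^ 2 + (q : ℝ) ^ 2 := by
  have : p ≠ 0 ∨ q ≠ 0 := by
    by_contra! h
    exact hpq (by simp [h.1, h.2])
  rcases this with h | h
  · have : (p : ℝ) ≠ 0 := by exact_mod_cast h
    positivity
  · have : (q : ℝ) ≠ 0 := by exact_mod_cast h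
    positivity

/-- The normalisation of the push cancels `p² + q²`, which leaves a bound on the height that is
uniform in `(p, q)` and below the spacing of half-integers. -/
theorem height_leftCurve (hpq : (p, q) ≠ (0, 0)) (t : ℝ) :
    p * (leftCurve p q t).2 - q * (leftCurve p q t).1 = t * (1 - t) / 4 := by
  have := (normSq_pos hpq).ne'
  simp only [leftCurve]
  field_simp
  ring

theorem height_leftCurve_mem (hpq : (p, q) ≠ (0, 0)) {t : ℝ} (ht : t ∈ Set.Ioo (0 : ℝ) 1) :
    0 < p * (leftCurve p q t).2 - q * (leftCurve p q t).1 ∧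
      p * (leftCurve p q t).2 - q * (leftCurve p q t).1 < 1 / 4 := by
  rw [height_leftCurve hpq]
  constructor <;> nlinarith [ht.1, ht.2]

theorem leftCurve_zero : leftCurve p q 0 = latticePoint (0, 0) := by simp [leftCurve, latticePoint]

theorem leftCurve_one : leftCurve p q 1 = latticePoint (p, q) := by simp [leftCurve, latticePoint]

theorem sideOf_leftCurve_sub (l r : ℤ × ℤ) (s t : ℝ) :
    sideOf l r (leftCurve p q s) - sideOf l r (leftCurve p q t) =
      (t - s) * ((height p q l - height p q r : ℤ) - (1 - t - s) *
        (((l.1 - r.1) * p + (l.2 - r.2) * q) / (4 * ((p : ℝ) ^ 2 + (q : ℝ) ^ 2)))) := by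
  simp only [sideOf, leftCurve, height]
  push_cast
  ring

/-- The undeformed line contributes the slope `height l - height r ≥ 1`. The push perturbs it by at
most `1/4`, because the coordinates of `l - r` are at most `1` in absolute value and `|z| ≤ z²` for
integers. Monotonicity makes a crossing of a given segment unique and reduces its existence to the
sides of the two ends of the curve. -/
theorem sideOf_leftCurve_lt (hpq : (p, q) ≠ (0, 0)) {l r : ℤ × ℤ} (hlr : LatticeAdj l r)
    (hh : height p q r < height p q l) {s t : ℝ} (hs : 0 ≤ s) (hst : s < t) (ht : t ≤ 1) :
    sideOf l r (leftCurve p q t) < sideOf l r (leftCurve p q s) := by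
  rw [← sub_pos, sideOf_leftCurve_sub]
  refine mul_pos (by linarith) ?_
  have hw : (1 : ℝ) ≤ (height p q l - height p q r : ℤ) := by
    exact_mod_cast (by omega : (1 : ℤ) ≤ height p q l - height p q r)
  have hD := normSq_pos hpq
  have hnum : |((l.1 : ℝ) - r.1) * p + ((l.2 : ℝ) - r.2) * q| ≤ (p : ℝ) ^ 2 + (q : ℝ) ^ 2 := by
    have hle : ∀ z : ℤ, |z| ≤ z ^ 2 := by
      intro z
      rw [← sq_abs]
      rcases (abs_nonneg z).eq_or_lt with h | h
      · simp [← h]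
      · nlinarith
    have hmul : ∀ u z : ℤ, |u| ≤ 1 → |u * z| ≤ z ^ 2 := by
      intro u z hu
      rw [abs_mul]
      nlinarith [hle z, abs_nonneg z]
    obtain ⟨h1, h2⟩ := hlr.abs_sub_le
    have := (abs_add_le ((l.1 - r.1) * p) ((l.2 - r.2) * q)).trans
      (add_le_add (hmul _ p h1) (hmul _ q h2))
    exact_mod_cast this
  have hquot : |(((l.1 : ℝ) - r.1) * p + ((l.2 : ℝ) - r.2) * q) /
      (4 * ((p : ℝ) ^ 2 + (q : ℝ) ^ 2))| ≤ 1 / 4 := by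
    rw [abs_div, abs_of_pos (by positivity : (0 : ℝ) < 4 * ((p : ℝ) ^ 2 + (q : ℝ) ^ 2)),
      div_le_div_iff₀ (by positivity) (by norm_num)]
    linarith
  have hfac : |1 - t - s| ≤ 1 := by
    rw [abs_le]; constructor <;> linarith
  have := mul_le_mul hfac hquot (abs_nonneg _) zero_le_one
  rw [← abs_mul] at this
  linarith [(abs_le.1 this).2]

theorem Crossing.sideOf_time {γ : ℝ → ℝ × ℝ} (c : Crossing γ) :
    sideOf c.left c.right (γ c.time) = 0 := by
  obtain ⟨a, -, -, h1, h2⟩ := exists_convex_of_mem_openSegment c.mem_segment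
  simp only [sideOf, h1, h2]
  ring

theorem Crossing.height_leftCurve_eq (c : Crossing (leftCurve p q)) :
    ∃ a : ℝ, 0 < a ∧ a < 1 ∧
      p * (leftCurve p q c.time).2 - q * (leftCurve p q c.time).1 =
        a * height p q c.left + (1 - a) * height p q c.right := by
  obtain ⟨a, ha, ha', h1, h2⟩ := exists_convex_of_mem_openSegment c.mem_segment
  refine ⟨a, ha, ha', ?_⟩
  rw [h1, h2]
  simp only [height]
  push_cast
  ring

/-- Equal heights would give the curve an integral height inside `(0, 1/4)`; the opposite inequality
would make `sideOf` increase along the curve, against the direction of the crossing. -/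
theorem Crossing.height_lt (hpq : (p, q) ≠ (0, 0)) (c : Crossing (leftCurve p q)) :
    height p q c.right < height p q c.left := by
  obtain ⟨a, ha, ha', h⟩ := c.height_leftCurve_eq
  obtain ⟨h0, h1⟩ := height_leftCurve_mem hpq c.time_mem
  rw [h] at h0 h1
  by_contra hle
  rcases (not_lt.1 hle).eq_or_lt with heq | hlt
  · rw [heq] at h0 h1
    have h0' : (0 : ℝ) < (height p q c.right : ℝ) := by linarith
    have h1' : (height p q c.right : ℝ) < 1 := by linarith
    norm_cast at h0' h1'
    omega
  · obtain ⟨s, hs, hs'⟩ := (c.before.and (Ioo_mem_nhdsLT c.time_mem.1)).exists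
    have := sideOf_leftCurve_lt hpq c.adj.symm hlt hs'.1.le hs'.2 c.time_mem.2.le
    rw [sideOf_swap, sideOf_swap c.left, c.sideOf_time] at this
    linarith

theorem Crossing.height_right_le (hpq : (p, q) ≠ (0, 0)) (c : Crossing (leftCurve p q)) :
    height p q c.right ≤ 0 := by
  obtain ⟨a, ha, ha', h⟩ := c.height_leftCurve_eq
  have h1 := (height_leftCurve_mem hpq c.time_mem).2
  have hlt : (height p q c.right : ℝ) < height p q c.left := by exact_mod_cast c.height_lt hpq
  have : (height p q c.right : ℝ) < 1 := by nlinarith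
  norm_cast at this
  omega

theorem Crossing.height_left_pos (hpq : (p, q) ≠ (0, 0)) (c : Crossing (leftCurve p q)) :
    0 < height p q c.left := by
  obtain ⟨a, ha, ha', h⟩ := c.height_leftCurve_eq
  have h0 := (height_leftCurve_mem hpq c.time_mem).1
  have hlt : (height p q c.right : ℝ) < height p q c.left := by exact_mod_cast c.height_lt hpq
  have : (0 : ℝ) < height p q c.left := by nlinarith
  exact_mod_cast this

theorem Crossing.side_start (hpq : (p, q) ≠ (0, 0)) (c : Crossing (leftCurve p q)) :
    0 < sideInt c.left c.right (0, 0) := by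
  have := sideOf_leftCurve_lt hpq c.adj (c.height_lt hpq) le_rfl c.time_mem.1 c.time_mem.2.le
  rw [c.sideOf_time, leftCurve_zero, sideOf_latticePoint] at this
  exact_mod_cast this

theorem Crossing.side_end (hpq : (p, q) ≠ (0, 0)) (c : Crossing (leftCurve p q)) :
    sideInt c.left c.right (p, q) < 0 := by
  have := sideOf_leftCurve_lt hpq c.adj (c.height_lt hpq) c.time_mem.1.le c.time_mem.2 le_rfl
  rw [c.sideOf_time, leftCurve_one, sideOf_latticePoint] at this
  exact_mod_cast this

theorem Crossing.time_lt_of_sideOf_pos (hpq : (p, q) ≠ (0, 0)) (c c' : Crossing (leftCurve p q))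
    (h : 0 < sideOf c'.left c'.right (leftCurve p q c.time)) : c.time < c'.time := by
  by_contra hle
  rcases (not_lt.1 hle).eq_or_lt with heq | hlt
  · rw [← heq, c'.sideOf_time] at h
    exact lt_irrefl _ h
  · have := sideOf_leftCurve_lt hpq c'.adj (c'.height_lt hpq) c'.time_mem.1.le hlt c.time_mem.2.le
    rw [c'.sideOf_time] at this
    linarith

theorem Crossing.eq_of_endpoints (hpq : (p, q) ≠ (0, 0)) {c c' : Crossing (leftCurve p q)}
    (hl : c.left = c'.left) (hr : c.right = c'.right) : c = c' := by
  have ht : c.time = c'.time := by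
    by_contra hne
    have key : ∀ d d' : Crossing (leftCurve p q), d.left = d'.left → d.right = d'.right →
        ¬ d.time < d'.time := by
      intro d d' hl hr hlt
      have := sideOf_leftCurve_lt hpq d.adj (d.height_lt hpq) d.time_mem.1.le hlt d'.time_mem.2.le
      rw [d.sideOf_time, hl, hr, d'.sideOf_time] at this
      exact lt_irrefl _ this
    rcases lt_or_gt_of_ne hne with h | h
    · exact key c c' hl hr h
    · exact key c' c hl.symm hr.symm h
  cases c
  cases c'
  simp only at hl hr ht
  subst hl hr ht
  rfl

/-- The crossing point of `c` is a convex combination of the common endpoint, which lies on the line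
of `c'`, and of the other endpoint; the latter alone decides its side, and thereby the order in
time. -/
theorem Crossing.time_lt_of_right_eq (hpq : (p, q) ≠ (0, 0)) (c c' : Crossing (leftCurve p q))
    (hr : c.right = c'.right) (h : 0 < sideInt c'.left c'.right c.left) : c.time < c'.time := by
  apply c.time_lt_of_sideOf_pos hpq
  obtain ⟨a, ha, ha', h1, h2⟩ := exists_convex_of_mem_openSegment c.mem_segment
  have : sideOf c'.left c'.right (leftCurve p q c.time) =
      a * (sideInt c'.left c'.right c.left : ℝ) := by
    simp only [sideOf, sideInt, h1, h2, hr]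
    push_cast
    ring
  rw [this]
  exact mul_pos ha (by exact_mod_cast h)

theorem Crossing.time_lt_of_left_eq (hpq : (p, q) ≠ (0, 0)) (c c' : Crossing (leftCurve p q))
    (hl : c.left = c'.left) (h : 0 < sideInt c'.left c'.right c.right) : c.time < c'.time := by
  apply c.time_lt_of_sideOf_pos hpq
  obtain ⟨a, ha, ha', h1, h2⟩ := exists_convex_of_mem_openSegment c.mem_segment
  have : sideOf c'.left c'.right (leftCurve p q c.time) =
      (1 - a) * (sideInt c'.left c'.right c.right : ℝ) := by
    simp only [sideOf, sideInt, h1, h2, hl]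
    push_cast
    ring
  rw [this]
  exact mul_pos (by linarith) (by exact_mod_cast h)

/-- Height is affine on the segment, so the question is whether the midpoint is higher than the
curve. The midpoint has half-integral height and the curve has height in `(0, 1/4)`; hence only the
sign of the midpoint matters, and height zero counts as closer to the left. -/
theorem Crossing.closerToRight_iff (hpq : (p, q) ≠ (0, 0)) (c : Crossing (leftCurve p q)) :
    c.CloserToRight ↔ 0 < height p q c.left + height p q c.right := by
  obtain ⟨a, ha, ha', h1, h2⟩ := exists_convex_of_mem_openSegment c.mem_segment
  obtain ⟨hh0, hh1⟩ := height_leftCurve_mem hpq c.time_mem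
  have hh : p * (leftCurve p q c.time).2 - q * (leftCurve p q c.time).1 =
      a * height p q c.left + (1 - a) * height p q c.right := by
    rw [h1, h2]
    simp only [height]
    push_cast
    ring
  rw [hh] at hh0 hh1
  have hlt : (height p q c.right : ℝ) < height p q c.left := by exact_mod_cast c.height_lt hpq
  have hR : leftCurve p q c.time - latticePoint c.right =
      a • (latticePoint c.left - latticePoint c.right) := by
    ext
    · simp [latticePoint, h1]; ring
    · simp [latticePoint, h2]; ring
  have hL : leftCurve p q c.time - latticePoint c.left =
      (-(1 - a)) • (latticePoint c.left - latticePoint c.right) := by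
    ext
    · simp [latticePoint, h1]; ring
    · simp [latticePoint, h2]; ring
  have hpos : 0 < ‖latticePoint c.left - latticePoint c.right‖ := by
    rw [norm_pos_iff, sub_ne_zero]
    intro heq
    have e1 : c.left.1 = c.right.1 := by simpa [latticePoint] using congrArg Prod.fst heq
    have e2 : c.left.2 = c.right.2 := by simpa [latticePoint] using congrArg Prod.snd heq
    have := c.height_lt hpq
    simp [height, e1, e2] at this
  unfold Crossing.CloserToRight
  rw [dist_eq_norm, dist_eq_norm, hR, hL, norm_smul, norm_smul, mul_lt_mul_iff_left₀ hpos,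
    Real.norm_eq_abs, Real.norm_eq_abs, abs_neg, abs_of_pos ha, abs_of_pos (by linarith)]
  constructor
  · intro h
    have : (0 : ℝ) < height p q c.left + height p q c.right := by nlinarith
    exact_mod_cast this
  · intro h
    have : (1 : ℝ) ≤ height p q c.left + height p q c.right := by exact_mod_cast h
    nlinarith

theorem continuous_leftCurve : Continuous (leftCurve p q) := by
  unfold leftCurve
  fun_prop

theorem exists_crossing (hpq : (p, q) ≠ (0, 0)) {l r : ℤ × ℤ} (hlr : LatticeAdj l r)
    (hr : height p q r ≤ 0) (hl : 0 < height p q l) (h0 : 0 < sideInt l r (0, 0))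
    (h1 : sideInt l r (p, q) < 0) :
    ∃ c : Crossing (leftCurve p q), c.left = l ∧ c.right = r := by
  have hlt : height p q r < height p q l := by omega
  have hcont : Continuous fun t => sideOf l r (leftCurve p q t) := by
    have := continuous_leftCurve (p := p) (q := q)
    unfold sideOf
    fun_prop
  have g0 : 0 < sideOf l r (leftCurve p q 0) := by
    rw [leftCurve_zero, sideOf_latticePoint]; exact_mod_cast h0
  have g1 : sideOf l r (leftCurve p q 1) < 0 := by
    rw [leftCurve_one, sideOf_latticePoint]; exact_mod_cast h1
  obtain ⟨t, ht, hgt⟩ := intermediate_value_Ioo' zero_le_one hcont.continuousOn ⟨g1, g0⟩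
  simp only at hgt
  refine ⟨⟨t, l, r, ht, hlr, ?_, ?_, ?_⟩, rfl, rfl⟩
  · obtain ⟨hh0, hh1⟩ := height_leftCurve_mem hpq ht
    have hr' : (height p q r : ℝ) ≤ 0 := by exact_mod_cast hr
    have hl' : (1 : ℝ) ≤ height p q l := by exact_mod_cast hl
    have hw : (0 : ℝ) < height p q l - height p q r := by linarith
    set H : ℝ := p * (leftCurve p q t).2 - q * (leftCurve p q t).1 with hH
    -- These weights are forced, since height is affine along the segment; they are positive because
    -- `height r ≤ 0 < H < 1/4 < height l`.
    refine ⟨(H - height p q r) / (height p q l - height p q r),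
      (height p q l - H) / (height p q l - height p q r), div_pos (by linarith) hw,
      div_pos (by linarith) hw, ?_, ?_⟩
    · rw [← add_div, div_eq_one_iff_eq hw.ne']; ring
    · simp only [sideOf] at hgt
      have hw' := hw.ne'
      ext
      · simp only [latticePoint, Prod.smul_mk, smul_eq_mul, Prod.mk_add_mk]
        rw [div_mul_eq_mul_div, div_mul_eq_mul_div, ← add_div, div_eq_iff hw', hH]
        simp only [height]
        push_cast
        linear_combination (p : ℝ) * hgt
      · simp only [latticePoint, Prod.smul_mk, smul_eq_mul, Prod.mk_add_mk]
        rw [div_mul_eq_mul_div, div_mul_eq_mul_div, ← add_div, div_eq_iff hw', hH]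
        simp only [height]
        push_cast
        linear_combination (q : ℝ) * hgt
  · filter_upwards [Ioo_mem_nhdsLT ht.1] with s hs
    have := sideOf_leftCurve_lt hpq hlr hlt hs.1.le hs.2 ht.2.le
    rwa [hgt] at this
  · filter_upwards [Ioo_mem_nhdsGT ht.2] with s hs
    have := sideOf_leftCurve_lt hpq hlr hlt ht.1.le hs.1 hs.2.le
    rwa [hgt] at this

theorem kMarkov_eq_chainVec (k : ℕ) (hpq : (p, q) ≠ (0, 0)) (N : ℕ) (l r : ℕ → ℤ × ℤ)
    (d s : ℕ → Bool) (hadj : ∀ i ≤ N, LatticeAdj (l i) (r i))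
    (hr : ∀ i ≤ N, height p q (r i) ≤ 0) (hl : ∀ i ≤ N, 0 < height p q (l i))
    (h0 : ∀ i ≤ N, 0 < sideInt (l i) (r i) (0, 0))
    (h1 : ∀ i ≤ N, sideInt (l i) (r i) (p, q) < 0)
    (hd : ∀ i ≤ N, 0 < height p q (l i) + height p q (r i) ↔ d i = true)
    (hs : ∀ i < N, s i = true ∧ r i = r (i + 1) ∧ 0 < sideInt (l (i + 1)) (r (i + 1)) (l i) ∨
      s i = false ∧ l i = l (i + 1) ∧ 0 < sideInt (l (i + 1)) (r (i + 1)) (r i))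
    (hall : ∀ a b, LatticeAdj a b → height p q b ≤ 0 → 0 < height p q a →
      0 < sideInt a b (0, 0) → sideInt a b (p, q) < 0 → ∃ i ≤ N, l i = a ∧ r i = b) :
    kMarkov k p q = ((fenceStep (d N))^[k] (chainVec k d s N)).1 +
        ((fenceStep (d N))^[k] (chainVec k d s N)).2 := by
  -- A default crossing is needed for the values of the sequence beyond `N`.
  have : Nonempty (Crossing (leftCurve p q)) := by
    obtain ⟨c, -⟩ := exists_crossing hpq (hadj 0 (by omega)) (hr 0 (by omega)) (hl 0 (by omega))
      (h0 0 (by omega)) (h1 0 (by omega))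
    exact ⟨c⟩
  choose! c hcl hcr using fun i (hi : i ≤ N) =>
    exists_crossing hpq (hadj i hi) (hr i hi) (hl i hi) (h0 i hi) (h1 i hi)
  refine CrossingSequence.card_lowerSet (c := c) ⟨?_, ?_, ?_, ?_, ?_⟩ k
  · intro i hi
    rcases hs i hi with ⟨-, heq, hpos⟩ | ⟨-, heq, hpos⟩
    · apply Crossing.time_lt_of_right_eq hpq
      · rw [hcr i (by omega), hcr (i + 1) (by omega), heq]
      · rwa [hcr (i + 1) (by omega), hcl (i + 1) (by omega), hcl i (by omega)]
    · apply Crossing.time_lt_of_left_eq hpq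
      · rw [hcl i (by omega), hcl (i + 1) (by omega), heq]
      · rwa [hcr (i + 1) (by omega), hcl (i + 1) (by omega), hcr i (by omega)]
  · intro e
    obtain ⟨i, hi, hil, hir⟩ := hall e.left e.right e.adj (e.height_right_le hpq)
      (e.height_left_pos hpq) (e.side_start hpq) (e.side_end hpq)
    exact ⟨i, hi, Crossing.eq_of_endpoints hpq (by rw [hcl i hi, hil]) (by rw [hcr i hi, hir])⟩
  · intro i hi
    rw [Crossing.closerToRight_iff hpq, hcl i hi, hcr i hi, hd i hi]
  · intro i hi
    rw [hcr i (by omega), hcr (i + 1) (by omega)]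
    rcases hs i hi with ⟨hsi, heq, hpos⟩ | ⟨hsi, heq, hpos⟩
    · simp [hsi, heq]
    -- Sharing the other endpoint too would put it on the line of the next segment, where `sideInt`
    -- vanishes.
    · simp only [hsi, Bool.false_eq_true, iff_false]
      intro h
      rw [h] at hpos
      simp [sideInt] at hpos
  · intro i hi
    rw [hcl i (by omega), hcl (i + 1) (by omega)]
    rcases hs i hi with ⟨hsi, heq, hpos⟩ | ⟨hsi, heq, hpos⟩
    · simp only [hsi, Bool.true_eq_false, iff_false]
      intro h
      rw [h] at hpos
      simp [sideInt] at hpos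
      nlinarith
    · simp [hsi, heq]

theorem kMarkov_eq_one (k : ℕ) (hpq : (p, q) ≠ (0, 0))
    (hall : ∀ a b, LatticeAdj a b → height p q b ≤ 0 → 0 < height p q a →
      0 < sideInt a b (0, 0) → sideInt a b (p, q) < 0 → False) :
    kMarkov k p q = 1 := by
  have hempty : IsEmpty (CurvePoset k (leftCurve p q)) := ⟨fun x =>
    hall x.1.left x.1.right x.1.adj (x.1.height_right_le hpq) (x.1.height_left_pos hpq)
      (x.1.side_start hpq) (x.1.side_end hpq)⟩
  have : Unique (LowerSet (CurvePoset k (leftCurve p q))) :=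
    ⟨⟨⊥⟩, fun S => LowerSet.ext (Set.eq_empty_of_isEmpty _ |>.trans
      (Set.eq_empty_of_isEmpty _).symm)⟩
  exact Nat.card_unique

end LeftCurve


/-! ### Algebra of transfer vectors and fences with a half-turn symmetry -/

theorem fenceStep_true_iterate (j a b : ℕ) : (fenceStep true)^[j] (a, b) = (a, b + j * a) := by
  induction j with
  | zero => simp
  | succ j ih => rw [Function.iterate_succ_apply', ih]; simp [fenceStep]; ring

theorem fenceStep_false_iterate (j a b : ℕ) : (fenceStep false)^[j] (a, b) = (a + j * b, b) := by
  induction j with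
  | zero => simp
  | succ j ih => rw [Function.iterate_succ_apply', ih]; simp [fenceStep]; ring

theorem chainVec_congr (k : ℕ) {d s d' s' : ℕ → Bool} {m : ℕ} (hd : ∀ i < m, d i = d' i)
    (hs : ∀ i < m, s i = s' i) : chainVec k d s m = chainVec k d' s' m := by
  induction m with
  | zero => rfl
  | succ m ih =>
    rw [chainVec, chainVec, ih (fun i hi => hd i (by omega)) (fun i hi => hs i (by omega)),
      hd m (by omega), hs m (by omega)]

/-- The standard pairing of transfer vectors. -/
def pairing (x y : ℕ × ℕ) : ℕ := x.1 * y.1 + x.2 * y.2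

/-- The two elementary unipotent matrices are transposes of each other: reading a fence backwards
reverses every edge. -/
theorem pairing_fenceStep (d : Bool) (x y : ℕ × ℕ) :
    pairing (fenceStep d x) y = pairing x (fenceStep (!d) y) := by
  cases d <;> simp [pairing, fenceStep] <;> ring

theorem pairing_fenceStep_iterate (d : Bool) (j : ℕ) (x y : ℕ × ℕ) :
    pairing ((fenceStep d)^[j] x) y = pairing x ((fenceStep (!d))^[j] y) := by
  induction j generalizing y with
  | zero => rfl
  | succ j ih =>
    rw [Function.iterate_succ_apply', pairing_fenceStep, ih, Function.iterate_succ_apply]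

/-- The number of ideals of a fence whose second half is opposite to its first half. -/
def halfForm (k : ℕ) (x : ℕ × ℕ) : ℕ := x.1 ^ 2 + k * x.1 * x.2 + x.2 ^ 2

/-- The total is the pairing with `(1, 1)`. Moving chains from the far end across the pairing
reverses their edges, and the symmetry reverses them again, so the right-hand vector grows exactly
like the left-hand one. They meet at the middle chain, whose `k` edges produce the mixed term. -/
theorem total_eq_halfForm (k m : ℕ) (d s : ℕ → Bool) (hm : d m = false)
    (hd : ∀ i < m, d (2 * m - i) = !d i) (hs : ∀ i < m, s (2 * m - 1 - i) = !s i) :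
    ((fenceStep (d (2 * m)))^[k] (chainVec k d s (2 * m))).1 +
      ((fenceStep (d (2 * m)))^[k] (chainVec k d s (2 * m))).2 =
        halfForm k (chainVec k d s m) := by
  have key : ∀ j ≤ m, ((fenceStep (d (2 * m)))^[k] (chainVec k d s (2 * m))).1 +
      ((fenceStep (d (2 * m)))^[k] (chainVec k d s (2 * m))).2 =
      pairing ((fenceStep (d (2 * m - j)))^[k] (chainVec k d s (2 * m - j)))
        (chainVec k d s j) := by
    intro j
    induction j with
    | zero => intro _; simp [pairing, chainVec]
    | succ j ih =>
      intro hj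
      have hsub : 2 * m - j = 2 * m - (j + 1) + 1 := by omega
      rw [ih (by omega), pairing_fenceStep_iterate, hd j (by omega), hsub, chainVec,
        pairing_fenceStep, show 2 * m - (j + 1) = 2 * m - 1 - j by omega, hs j (by omega),
        Bool.not_not, Bool.not_not, chainVec]
  rw [key m le_rfl, show 2 * m - m = m by omega, hm]
  obtain ⟨a, b⟩ := chainVec k d s m
  rw [fenceStep_false_iterate]
  simp only [pairing, halfForm]
  ring

/-! ### Addition formulas and recursions for the transfer vectors -/

/-- The transfer vectors along `γ^L_{(n,0)}`, at every second crossing. -/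
def rowVec (k : ℕ) : ℕ → ℕ × ℕ
  | 0 => (1, 1)
  | n + 1 => ((2 * k + 2) * (rowVec k n).1 + (rowVec k n).2,
      (2 * k + 1) * (rowVec k n).1 + (rowVec k n).2)

/-- `rowVec` iterates a fixed 2×2 matrix; the coefficients on the right form the first row of its
power `s + 1`. The induction shifts one period from `s` to `t`. -/
theorem rowVec_add (k s t : ℕ) : (rowVec k (s + t + 1)).1 =
    ((2 * k + 1) * (rowVec k s).1 + (rowVec k s).2) * (rowVec k t).1 +
      (rowVec k s).1 * (rowVec k t).2 := by
  induction s generalizing t with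
  | zero => simp [rowVec]
  | succ s ih =>
    rw [show s + 1 + t + 1 = s + (t + 1) + 1 by ring, ih (t + 1)]
    simp only [rowVec]
    ring

theorem chainVec_row (k n : ℕ) :
    chainVec k (fun _ => true) (fun i => decide (i % 2 = 0)) (2 * n) = rowVec k n ∧
    chainVec k (fun _ => true) (fun i => decide (i % 2 = 0)) (2 * n + 1) =
      ((rowVec k n).1, (rowVec k n).2 + (k + 1) * (rowVec k n).1) := by
  have step : ∀ n, chainVec k (fun _ => true) (fun i => decide (i % 2 = 0)) (2 * n) =
      rowVec k n → chainVec k (fun _ => true) (fun i => decide (i % 2 = 0)) (2 * n + 1) =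
      ((rowVec k n).1, (rowVec k n).2 + (k + 1) * (rowVec k n).1) := by
    intro n h
    rw [chainVec, h, ← Prod.mk.eta (p := rowVec k n), fenceStep_true_iterate]
    simp [fenceStep]
    ring
  induction n with
  | zero => exact ⟨rfl, step 0 rfl⟩
  | succ n ih =>
    have h : chainVec k (fun _ => true) (fun i => decide (i % 2 = 0)) (2 * (n + 1)) =
        rowVec k (n + 1) := by
      rw [show 2 * (n + 1) = 2 * n + 1 + 1 by ring, chainVec, ih.2, fenceStep_true_iterate]
      simp [fenceStep, rowVec, show (2 * n + 1) % 2 = 1 by omega]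
      constructor <;> ring
    exact ⟨h, step _ h⟩

/-- One more chain with its link adds `k + 1` times one coordinate to the other, alternately, so the
increment of the form has the factor `k + 1`; `rowVec_add` at the half index recognises the
cofactor. -/
theorem halfForm_row (k n : ℕ) :
    halfForm k (chainVec k (fun _ => true) (fun i => decide (i % 2 = 0)) (n + 1)) =
      (k + 1) * (rowVec k (n + 1)).1 +
        halfForm k (chainVec k (fun _ => true) (fun i => decide (i % 2 = 0)) n) := by
  rcases Nat.even_or_odd' n with ⟨i, rfl | rfl⟩
  · rw [(chainVec_row k i).1, (chainVec_row k i).2, show 2 * i + 1 = i + i + 1 by ring,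
      rowVec_add]
    simp only [halfForm]
    ring
  · rw [show 2 * i + 1 + 1 = 2 * (i + 1) by ring, (chainVec_row k i).2,
      (chainVec_row k (i + 1)).1, show 2 * (i + 1) = i + 1 + i + 1 by ring, rowVec_add]
    simp only [halfForm, rowVec]
    ring

/-- A linear recursion that governs the transfer vectors along `γ^L_{(n,n)}`. -/
def diagVec (k : ℕ) : ℕ → ℕ × ℕ
  | 0 => (1, 0)
  | n + 1 => ((diagVec k n).1 + (3 * k + 2) * ((diagVec k n).2 + (k + 2) * (diagVec k n).1),
      (diagVec k n).2 + (k + 2) * (diagVec k n).1)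

theorem diagVec_add (k s t : ℕ) : (diagVec k (s + t + 1)).2 =
    (diagVec k s).1 * (diagVec k (t + 1)).2 + (diagVec k s).2 * (diagVec k t).1 := by
  induction s generalizing t with
  | zero => simp [diagVec]
  | succ s ih =>
    rw [show s + 1 + t + 1 = s + (t + 1) + 1 by ring, ih (t + 1)]
    simp only [diagVec]
    ring

/-- Edges of equal direction form runs. The three segments around an interior integral point of the
diagonal give `3k + 2` edges (three chains and two links); the antidiagonal through a half-integral
point, with its two outer links, gives `k + 2`. These are the coefficients of `diagVec`. -/
theorem chainVec_diag (k n : ℕ) :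
    chainVec k (fun i => decide (i % 4 ≠ 0)) (fun i => decide (i % 4 = 1 ∨ i % 4 = 2)) (4 * n) =
      ((diagVec k n).1 + (diagVec k n).2, (diagVec k n).1) := by
  induction n with
  | zero => simp [chainVec, diagVec]
  | succ n ih =>
    rw [show 4 * (n + 1) = 4 * n + 1 + 1 + 1 + 1 by ring, chainVec, chainVec, chainVec, chainVec,
      ih]
    simp [show (4 * n) % 4 = 0 by omega, show (4 * n + 1) % 4 = 1 by omega,
      show (4 * n + 1 + 1) % 4 = 2 by omega, show (4 * n + 1 + 1 + 1) % 4 = 3 by omega,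
      fenceStep_true_iterate, fenceStep_false_iterate, fenceStep, diagVec]
    constructor <;> ring

/-- The runs again have lengths `k + 2` and `3k + 2`, with the directions exchanged, so the same
recursion governs this fence. The indices `4n + 1` and `4n + 3` are the possible middles, as the
half length is odd. -/
theorem chainVec_nearDiag (k n : ℕ) :
    chainVec k (fun i => decide (i % 4 = 0)) (fun i => decide (i % 4 = 0 ∨ i % 4 = 3))
      (4 * n + 1) = ((diagVec k n).1, (diagVec k (n + 1)).2) ∧
    chainVec k (fun i => decide (i % 4 = 0)) (fun i => decide (i % 4 = 0 ∨ i % 4 = 3))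
      (4 * n + 3) = ((diagVec k n).1 + (2 * k + 2) * (diagVec k (n + 1)).2,
        (diagVec k (n + 1)).2) := by
  have step : ∀ n, chainVec k (fun i => decide (i % 4 = 0))
      (fun i => decide (i % 4 = 0 ∨ i % 4 = 3)) (4 * n + 1) =
        ((diagVec k n).1, (diagVec k (n + 1)).2) →
      chainVec k (fun i => decide (i % 4 = 0)) (fun i => decide (i % 4 = 0 ∨ i % 4 = 3))
        (4 * n + 3) = ((diagVec k n).1 + (2 * k + 2) * (diagVec k (n + 1)).2,
          (diagVec k (n + 1)).2) := by
    intro n h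
    rw [show 4 * n + 3 = 4 * n + 1 + 1 + 1 by ring, chainVec, chainVec, h]
    simp [show (4 * n + 1) % 4 = 1 by omega, show (4 * n + 1 + 1) % 4 = 2 by omega,
      fenceStep_false_iterate, fenceStep]
    ring
  induction n with
  | zero =>
    have h : chainVec k (fun i => decide (i % 4 = 0)) (fun i => decide (i % 4 = 0 ∨ i % 4 = 3))
        (4 * 0 + 1) = ((diagVec k 0).1, (diagVec k (0 + 1)).2) := by
      simp [chainVec, diagVec, fenceStep_true_iterate, fenceStep]
      ring
    exact ⟨h, step 0 h⟩
  | succ n ih =>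
    have h : chainVec k (fun i => decide (i % 4 = 0)) (fun i => decide (i % 4 = 0 ∨ i % 4 = 3))
        (4 * (n + 1) + 1) = ((diagVec k (n + 1)).1, (diagVec k (n + 1 + 1)).2) := by
      rw [show 4 * (n + 1) + 1 = 4 * n + 3 + 1 + 1 by ring, chainVec, chainVec, ih.2]
      simp [show (4 * n + 3) % 4 = 3 by omega, show (4 * n + 3 + 1) % 4 = 0 by omega,
        fenceStep_true_iterate, fenceStep_false_iterate, fenceStep, diagVec]
      constructor <;> ring
    exact ⟨h, step _ h⟩

theorem halfForm_nearDiag_one (k : ℕ) :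
    halfForm k (chainVec k (fun i => decide (i % 4 = 0))
      (fun i => decide (i % 4 = 0 ∨ i % 4 = 3)) 1) = 2 * (k + 1) * (diagVec k 1).2 + 1 := by
  rw [(chainVec_nearDiag k 0).1]
  simp only [halfForm, diagVec]
  ring

theorem halfForm_nearDiag (k n : ℕ) :
    halfForm k (chainVec k (fun i => decide (i % 4 = 0))
      (fun i => decide (i % 4 = 0 ∨ i % 4 = 3)) (2 * n + 3)) =
    2 * (k + 1) * (diagVec k (n + 2)).2 + halfForm k (chainVec k (fun i => decide (i % 4 = 0))
      (fun i => decide (i % 4 = 0 ∨ i % 4 = 3)) (2 * n + 1)) := by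
  rcases Nat.even_or_odd' n with ⟨i, rfl | rfl⟩
  · rw [show 2 * (2 * i) + 3 = 4 * i + 3 by ring, show 2 * (2 * i) + 1 = 4 * i + 1 by ring,
      (chainVec_nearDiag k i).1, (chainVec_nearDiag k i).2,
      show 2 * i + 2 = i + 1 + i + 1 by ring, diagVec_add]
    simp only [halfForm, diagVec]
    ring
  · rw [show 2 * (2 * i + 1) + 3 = 4 * (i + 1) + 1 by ring,
      show 2 * (2 * i + 1) + 1 = 4 * i + 3 by ring, (chainVec_nearDiag k (i + 1)).1,
      (chainVec_nearDiag k i).2, show 2 * i + 1 + 2 = i + 1 + (i + 1) + 1 by ring,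
      diagVec_add k (i + 1) (i + 1)]
    simp only [halfForm, diagVec]
    ring


/-! ### Listing the crossings of the four families of curves -/

/-- For `p, q ≥ 0` only the steps `(0, 1)`, `(-1, 0)` and `(-1, 1)` can raise the height. The side
conditions at the two ends become bounds on `x`, `y` and `x + y` respectively. -/
theorem crossing_cases {p q : ℤ} (hp : 0 ≤ p) (hq : 0 ≤ q) {a b : ℤ × ℤ} (hab : LatticeAdj a b)
    (hb : height p q b ≤ 0) (ha : 0 < height p q a) (h0 : 0 < sideInt a b (0, 0))
    (h1 : sideInt a b (p, q) < 0) :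
    (∃ x y, a = (x, y + 1) ∧ b = (x, y) ∧ p * y - q * x ≤ 0 ∧ 0 < p * (y + 1) - q * x ∧
      0 < x ∧ x < p) ∨
    (∃ x y, a = (x - 1, y) ∧ b = (x, y) ∧ p * y - q * x ≤ 0 ∧ 0 < p * y - q * (x - 1) ∧
      0 < y ∧ y < q) ∨
    (∃ x y, a = (x - 1, y + 1) ∧ b = (x, y) ∧ p * y - q * x ≤ 0 ∧
      0 < p * (y + 1) - q * (x - 1) ∧ 0 < x + y ∧ x + y < p + q) := by
  obtain ⟨a1, a2⟩ := a
  obtain ⟨x, y⟩ := b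
  simp only [LatticeAdj, Prod.mk_sub_mk, Prod.mk.injEq] at hab
  simp only [height, sideInt] at hb ha h0 h1
  rcases hab with ⟨e1, e2⟩ | ⟨e1, e2⟩ | ⟨e1, e2⟩ | ⟨e1, e2⟩ | ⟨e1, e2⟩ | ⟨e1, e2⟩
  · obtain rfl : a1 = x - 1 := by omega
    obtain rfl : a2 = y := by omega
    refine Or.inr (Or.inl ⟨x, a2, rfl, rfl, hb, ha, ?_, ?_⟩) <;> linarith
  · obtain rfl : a1 = x + 1 := by omega
    obtain rfl : a2 = y := by omega
    linarith
  · obtain rfl : a1 = x := by omega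
    obtain rfl : a2 = y - 1 := by omega
    linarith
  · obtain rfl : a1 = x := by omega
    obtain rfl : a2 = y + 1 := by omega
    refine Or.inl ⟨a1, y, rfl, rfl, hb, ha, ?_, ?_⟩ <;> linarith
  · obtain rfl : a1 = x - 1 := by omega
    obtain rfl : a2 = y + 1 := by omega
    refine Or.inr (Or.inr ⟨x, y, rfl, rfl, hb, ha, ?_, ?_⟩) <;> linarith
  · obtain rfl : a1 = x + 1 := by omega
    obtain rfl : a2 = y - 1 := by omega
    linarith

theorem kMarkov_zero_one (k : ℕ) : kMarkov k 0 1 = 1 := by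
  refine kMarkov_eq_one k (by simp) fun a b hab hb ha h0 h1 => ?_
  rcases crossing_cases (by omega) (by omega) hab hb ha h0 h1 with
    ⟨x, y, -, -, h⟩ | ⟨x, y, -, -, h⟩ | ⟨x, y, -, -, h⟩ <;> omega

theorem kMarkov_one_zero (k : ℕ) : kMarkov k 1 0 = 1 := by
  refine kMarkov_eq_one k (by simp) fun a b hab hb ha h0 h1 => ?_
  rcases crossing_cases (by omega) (by omega) hab hb ha h0 h1 with
    ⟨x, y, -, -, h⟩ | ⟨x, y, -, -, h⟩ | ⟨x, y, -, -, h⟩ <;> omega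

theorem kMarkov_row_zero (k n : ℕ) : kMarkov k ((n : ℤ) + 1) 0 = (rowVec k n).1 := by
  -- The curve to `(1, 0)` has no crossings, while a sequence `0, …, N` has at least one.
  obtain _ | n := n
  · simpa [rowVec] using kMarkov_one_zero k
  have hn : (0 : ℤ) < ((n + 1 : ℕ) : ℤ) + 1 := by omega
  set p : ℤ := ((n + 1 : ℕ) : ℤ) + 1 with hp
  have key : ∀ i ≤ 2 * n + 1, LatticeAdj (((i : ℤ) + 1) / 2, 1) ((i : ℤ) / 2 + 1, 0) ∧
      0 < sideInt (((i : ℤ) + 1) / 2, 1) ((i : ℤ) / 2 + 1, 0) (0, 0) ∧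
      sideInt (((i : ℤ) + 1) / 2, 1) ((i : ℤ) / 2 + 1, 0) (p, 0) < 0 := by
    intro i hi
    simp only [LatticeAdj, Prod.mk_sub_mk, Prod.mk.injEq, sideInt, sub_self, mul_zero]
    omega
  rw [kMarkov_eq_chainVec k (by simp; omega) (2 * n + 1) (fun i => (((i : ℤ) + 1) / 2, 1))
    (fun i => ((i : ℤ) / 2 + 1, 0)) (fun _ => true) (fun i => decide (i % 2 = 0))
    (fun i hi => (key i hi).1) (by simp [height]) (by simpa [height] using fun _ _ => hn)
    (fun i hi => (key i hi).2.1) (fun i hi => (key i hi).2.2)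
    (by simpa [height] using fun _ _ => hn) ?_ ?_, (chainVec_row k n).2, fenceStep_true_iterate]
  · simp only [rowVec]
    ring
  · intro i hi
    simp only [Prod.mk.injEq, sideInt, decide_eq_true_eq, decide_eq_false_iff_not,
      and_true]
    push_cast
    omega
  · intro a b hab hb ha h0 h1
    rcases crossing_cases (by omega) le_rfl hab hb ha h0 h1 with
      ⟨x, y, rfl, rfl, h, h', hx, hx'⟩ | ⟨x, y, -, -, h⟩ | ⟨x, y, rfl, rfl, h, h', hx, hx'⟩
    · have hy : y ≤ 0 := by nlinarith
      have hy' : 0 < y + 1 := by nlinarith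
      refine ⟨(2 * x - 1).toNat, by omega, ?_⟩
      simp only [Prod.mk.injEq]
      omega
    · omega
    · have hy : y ≤ 0 := by nlinarith
      have hy' : 0 < y + 1 := by nlinarith
      -- Throughout, the antidiagonal `x + y = c` is crossing number `2c - 2`; the other segments
      -- occupy the odd numbers.
      refine ⟨(2 * x - 2).toNat, by omega, ?_⟩
      simp only [Prod.mk.injEq]
      omega

theorem kMarkov_row_one (k n : ℕ) : kMarkov k ((n : ℤ) + 1) 1 =
    halfForm k (chainVec k (fun _ => true) (fun i => decide (i % 2 = 0)) n) := by
  have hn : (0 : ℤ) < (n : ℤ) + 1 := by omega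
  set p : ℤ := (n : ℤ) + 1 with hp
  have key : ∀ i ≤ 2 * n, LatticeAdj (((i : ℤ) + 1) / 2, 1) ((i : ℤ) / 2 + 1, 0) ∧
      0 < sideInt (((i : ℤ) + 1) / 2, 1) ((i : ℤ) / 2 + 1, 0) (0, 0) ∧
      sideInt (((i : ℤ) + 1) / 2, 1) ((i : ℤ) / 2 + 1, 0) (p, 1) < 0 ∧
      height p 1 ((i : ℤ) / 2 + 1, 0) ≤ 0 ∧ 0 < height p 1 (((i : ℤ) + 1) / 2, 1) := by
    intro i hi
    simp only [LatticeAdj, Prod.mk_sub_mk, Prod.mk.injEq, sideInt, height, mul_zero, mul_one]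
    omega
  -- The endpoint heights of the `i`-th segment add up to `n - i`, so the nearer endpoint changes
  -- sides at the middle crossing `i = n`.
  rw [kMarkov_eq_chainVec k (by simp) (2 * n) (fun i => (((i : ℤ) + 1) / 2, 1))
    (fun i => ((i : ℤ) / 2 + 1, 0)) (fun i => decide (i < n)) (fun i => decide (i % 2 = 0))
    (fun i hi => (key i hi).1) (fun i hi => (key i hi).2.2.2.1) (fun i hi => (key i hi).2.2.2.2)
    (fun i hi => (key i hi).2.1) (fun i hi => (key i hi).2.2.1) ?_ ?_ ?_,
    total_eq_halfForm k n (fun i => decide (i < n)) (fun i => decide (i % 2 = 0))]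
  -- Before the middle the fence agrees with that of the horizontal curve.
  · exact congrArg _ (chainVec_congr k (fun i hi => by simpa using hi) fun _ _ => rfl)
  · simp
  · intro i hi
    simp [hi]
    omega
  · intro i hi
    rw [← decide_not]
    exact decide_eq_decide.2 (by omega)
  · intro i hi
    simp only [height, decide_eq_true_eq]
    omega
  · intro i hi
    simp only [Prod.mk.injEq, sideInt, decide_eq_true_eq, decide_eq_false_iff_not,
      and_true]
    push_cast
    omega
  · intro a b hab hb ha h0 h1
    rcases crossing_cases (by omega) (by omega) hab hb ha h0 h1 with
      ⟨x, y, rfl, rfl, h, h', hx, hx'⟩ | ⟨x, y, -, -, h⟩ | ⟨x, y, rfl, rfl, h, h', hx, hx'⟩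
    · have hy : y < 1 := by nlinarith
      have hy' : 0 < y + 1 := by nlinarith
      refine ⟨(2 * x - 1).toNat, by omega, ?_⟩
      simp only [Prod.mk.injEq]
      omega
    · omega
    · have hy : y < 1 := by
        by_contra hy
        nlinarith
      have hy' : 0 < y + 1 := by
        by_contra hy'
        nlinarith
      refine ⟨(2 * x - 2).toNat, by omega, ?_⟩
      simp only [Prod.mk.injEq]
      omega

/-- The left endpoints of the segments that `γ^L_{(n,n)}` crosses. -/
def diagLeft (i : ℕ) : ℤ × ℤ := (((i : ℤ) + 1) / 4, ((i : ℤ) + 2) / 4 + 1)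

/-- The right endpoints of the segments that `γ^L_{(n,n)}` crosses. -/
def diagRight (i : ℕ) : ℤ × ℤ := ((i : ℤ) / 4 + 1, ((i : ℤ) + 3) / 4)

theorem diagLeft_eq (j : ℕ) : diagLeft (4 * j) = ((j : ℤ), (j : ℤ) + 1) ∧
    diagLeft (4 * j + 1) = ((j : ℤ), (j : ℤ) + 1) ∧
    diagLeft (4 * j + 2) = ((j : ℤ), (j : ℤ) + 2) ∧
    diagLeft (4 * j + 3) = ((j : ℤ) + 1, (j : ℤ) + 2) ∧
    diagLeft (4 * j + 4) = ((j : ℤ) + 1, (j : ℤ) + 2) := by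
  simp only [diagLeft, Prod.mk.injEq]
  push_cast
  omega

theorem diagRight_eq (j : ℕ) : diagRight (4 * j) = ((j : ℤ) + 1, (j : ℤ)) ∧
    diagRight (4 * j + 1) = ((j : ℤ) + 1, (j : ℤ) + 1) ∧
    diagRight (4 * j + 2) = ((j : ℤ) + 1, (j : ℤ) + 1) ∧
    diagRight (4 * j + 3) = ((j : ℤ) + 1, (j : ℤ) + 1) ∧
    diagRight (4 * j + 4) = ((j : ℤ) + 2, (j : ℤ) + 1) := by
  simp only [diagRight, Prod.mk.injEq]
  push_cast
  omega

theorem exists_eq_four_mul_add (i : ℕ) :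
    ∃ j, i = 4 * j ∨ i = 4 * j + 1 ∨ i = 4 * j + 2 ∨ i = 4 * j + 3 :=
  ⟨i / 4, by omega⟩

theorem kMarkov_diag (k n : ℕ) :
    kMarkov k ((n : ℤ) + 1) ((n : ℤ) + 1) = (diagVec k (n + 1)).2 := by
  have hn : (0 : ℤ) < (n : ℤ) + 1 := by omega
  set p : ℤ := (n : ℤ) + 1 with hp
  -- In this form the factor of `p` is a numeral at each listed endpoint, so the inequalities become
  -- linear.
  have hheight : ∀ a, height p p a = p * (a.2 - a.1) := fun a => by simp only [height]; ring
  have key : ∀ i ≤ 4 * n, LatticeAdj (diagLeft i) (diagRight i) ∧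
      height p p (diagRight i) ≤ 0 ∧ 0 < height p p (diagLeft i) ∧
      0 < sideInt (diagLeft i) (diagRight i) (0, 0) ∧
      sideInt (diagLeft i) (diagRight i) (p, p) < 0 ∧
      (0 < height p p (diagLeft i) + height p p (diagRight i) ↔ decide (i % 4 ≠ 0) = true) := by
    intro i hi
    obtain ⟨j, rfl | rfl | rfl | rfl⟩ := exists_eq_four_mul_add i <;>
    · simp only [diagLeft_eq, diagRight_eq, LatticeAdj, Prod.mk_sub_mk, Prod.mk.injEq, sideInt,
        hheight, decide_eq_true_eq]
      omega
  rw [kMarkov_eq_chainVec k (by simp; omega) (4 * n) diagLeft diagRight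
    (fun i => decide (i % 4 ≠ 0)) (fun i => decide (i % 4 = 1 ∨ i % 4 = 2))
    (fun i hi => (key i hi).1) (fun i hi => (key i hi).2.1) (fun i hi => (key i hi).2.2.1)
    (fun i hi => (key i hi).2.2.2.1) (fun i hi => (key i hi).2.2.2.2.1)
    (fun i hi => (key i hi).2.2.2.2.2) ?_ ?_, chainVec_diag,
    show decide (4 * n % 4 ≠ 0) = false by simp, fenceStep_false_iterate]
  · simp only [diagVec]
    ring
  · intro i hi
    obtain ⟨j, rfl | rfl | rfl | rfl⟩ := exists_eq_four_mul_add i <;>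
    · simp only [add_assoc, Nat.reduceAdd, diagLeft_eq, diagRight_eq,
        Prod.mk.injEq, sideInt, decide_eq_true_eq,
        decide_eq_false_iff_not, and_true, true_and]
      omega
  · intro a b hab hb ha h0 h1
    rcases crossing_cases hn.le hn.le hab hb ha h0 h1 with
      ⟨x, y, rfl, rfl, h, h', hx, hx'⟩ | ⟨x, y, rfl, rfl, h, h', hx, hx'⟩ |
      ⟨x, y, rfl, rfl, h, h', hx, hx'⟩
    · have hy : y ≤ x := by nlinarith
      have hy' : x < y + 1 := by nlinarith
      refine ⟨(4 * x - 1).toNat, by omega, ?_⟩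
      simp only [diagLeft, diagRight, Prod.mk.injEq]
      omega
    · have hy : y ≤ x := by nlinarith
      have hy' : x < y + 1 := by nlinarith
      refine ⟨(4 * x - 3).toNat, by omega, ?_⟩
      simp only [diagLeft, diagRight, Prod.mk.injEq]
      omega
    · have hy : y ≤ x := by nlinarith
      have hy' : x < y + 2 := by nlinarith
      refine ⟨(2 * (x + y) - 2).toNat, by omega, ?_⟩
      simp only [diagLeft, diagRight, Prod.mk.injEq]
      omega

/-- The left endpoints of the segments that `γ^L_{(n+1,n)}` crosses. -/
def nearDiagLeft (i : ℕ) : ℤ × ℤ := (((i : ℤ) + 3) / 4, (i : ℤ) / 4 + 1)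

/-- The right endpoints of the segments that `γ^L_{(n+1,n)}` crosses. -/
def nearDiagRight (i : ℕ) : ℤ × ℤ := (((i : ℤ) + 2) / 4 + 1, ((i : ℤ) + 1) / 4)

theorem nearDiagLeft_eq (j : ℕ) : nearDiagLeft (4 * j) = ((j : ℤ), (j : ℤ) + 1) ∧
    nearDiagLeft (4 * j + 1) = ((j : ℤ) + 1, (j : ℤ) + 1) ∧
    nearDiagLeft (4 * j + 2) = ((j : ℤ) + 1, (j : ℤ) + 1) ∧
    nearDiagLeft (4 * j + 3) = ((j : ℤ) + 1, (j : ℤ) + 1) ∧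
    nearDiagLeft (4 * j + 4) = ((j : ℤ) + 1, (j : ℤ) + 2) := by
  simp only [nearDiagLeft, Prod.mk.injEq]
  push_cast
  omega

theorem nearDiagRight_eq (j : ℕ) : nearDiagRight (4 * j) = ((j : ℤ) + 1, (j : ℤ)) ∧
    nearDiagRight (4 * j + 1) = ((j : ℤ) + 1, (j : ℤ)) ∧
    nearDiagRight (4 * j + 2) = ((j : ℤ) + 2, (j : ℤ)) ∧
    nearDiagRight (4 * j + 3) = ((j : ℤ) + 2, (j : ℤ) + 1) ∧
    nearDiagRight (4 * j + 4) = ((j : ℤ) + 2, (j : ℤ) + 1) := by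
  simp only [nearDiagRight, Prod.mk.injEq]
  push_cast
  omega

theorem kMarkov_nearDiag (k n : ℕ) : kMarkov k ((n : ℤ) + 2) ((n : ℤ) + 1) =
    halfForm k (chainVec k (fun i => decide (i % 4 = 0))
      (fun i => decide (i % 4 = 0 ∨ i % 4 = 3)) (2 * n + 1)) := by
  have hn : (0 : ℤ) < (n : ℤ) + 1 := by omega
  rw [show (n : ℤ) + 2 = (n : ℤ) + 1 + 1 by ring]
  set q : ℤ := (n : ℤ) + 1 with hq
  have hheight : ∀ a, height (q + 1) q a = q * (a.2 - a.1) + a.2 := fun a => by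
    simp only [height]; ring
  -- For odd `i` the endpoint heights add up to `(i + 1) / 2 - q`, which vanishes exactly at the
  -- middle `i = 2n + 1`; for even `i` the sign depends only on `i` modulo `4`.
  have key : ∀ i ≤ 2 * (2 * n + 1), LatticeAdj (nearDiagLeft i) (nearDiagRight i) ∧
      height (q + 1) q (nearDiagRight i) ≤ 0 ∧ 0 < height (q + 1) q (nearDiagLeft i) ∧
      0 < sideInt (nearDiagLeft i) (nearDiagRight i) (0, 0) ∧
      sideInt (nearDiagLeft i) (nearDiagRight i) (q + 1, q) < 0 ∧
      (0 < height (q + 1) q (nearDiagLeft i) + height (q + 1) q (nearDiagRight i) ↔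
        decide (i % 4 = 0 ∨ i % 2 = 1 ∧ 2 * n + 1 < i) = true) := by
    intro i hi
    obtain ⟨j, rfl | rfl | rfl | rfl⟩ := exists_eq_four_mul_add i <;>
    · simp only [nearDiagLeft_eq, nearDiagRight_eq, LatticeAdj, Prod.mk_sub_mk, Prod.mk.injEq,
        sideInt, hheight, decide_eq_true_eq]
      omega
  rw [kMarkov_eq_chainVec k (by simp; omega) (2 * (2 * n + 1)) nearDiagLeft nearDiagRight
    (fun i => decide (i % 4 = 0 ∨ i % 2 = 1 ∧ 2 * n + 1 < i))
    (fun i => decide (i % 4 = 0 ∨ i % 4 = 3))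
    (fun i hi => (key i hi).1) (fun i hi => (key i hi).2.1) (fun i hi => (key i hi).2.2.1)
    (fun i hi => (key i hi).2.2.2.1) (fun i hi => (key i hi).2.2.2.2.1)
    (fun i hi => (key i hi).2.2.2.2.2) ?_ ?_,
    total_eq_halfForm k (2 * n + 1) (fun i => decide (i % 4 = 0 ∨ i % 2 = 1 ∧ 2 * n + 1 < i))
      (fun i => decide (i % 4 = 0 ∨ i % 4 = 3))]
  · exact congrArg _ (chainVec_congr k (fun i hi => decide_eq_decide.2 (by omega)) fun _ _ => rfl)
  · exact decide_eq_false (by omega)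
  · intro i hi
    rw [← decide_not]
    exact decide_eq_decide.2 (by omega)
  · intro i hi
    rw [← decide_not]
    exact decide_eq_decide.2 (by omega)
  · intro i hi
    obtain ⟨j, rfl | rfl | rfl | rfl⟩ := exists_eq_four_mul_add i <;>
    · simp only [add_assoc, Nat.reduceAdd, nearDiagLeft_eq, nearDiagRight_eq,
        Prod.mk.injEq, sideInt, decide_eq_true_eq,
        decide_eq_false_iff_not, and_true, true_and]
      omega
  · intro a b hab hb ha h0 h1
    rcases crossing_cases (by omega) hn.le hab hb ha h0 h1 with
      ⟨x, y, rfl, rfl, h, h', hx, hx'⟩ | ⟨x, y, rfl, rfl, h, h', hx, hx'⟩ |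
      ⟨x, y, rfl, rfl, h, h', hx, hx'⟩
    · have hy : y < x := by
        by_contra hy
        nlinarith
      have hy' : x - 2 < y := by
        by_contra hy
        nlinarith
      refine ⟨(4 * x - 3).toNat, by omega, ?_⟩
      simp only [nearDiagLeft, nearDiagRight, Prod.mk.injEq]
      omega
    · have hy : y < x := by
        by_contra hy
        nlinarith
      have hy' : x - 2 < y := by
        by_contra hy
        nlinarith
      refine ⟨(4 * y - 1).toNat, by omega, ?_⟩
      simp only [nearDiagLeft, nearDiagRight, Prod.mk.injEq]
      omega
    · have hy : y < x := by
        by_contra hy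
        nlinarith
      have hy' : x - 3 < y := by
        by_contra hy
        nlinarith
      refine ⟨(2 * (x + y) - 2).toNat, by omega, ?_⟩
      simp only [nearDiagLeft, nearDiagRight, Prod.mk.injEq]
      omega

/-! ### The two recurrences -/

theorem proposition4 (k n : ℕ) (hn : 1 ≤ n) :
    kMarkov k n 1 = (k + 1) * kMarkov k n 0 + kMarkov k ((n : ℤ) - 1) 1 ∧
      kMarkov k ((n : ℤ) + 1) n = 2 * (k + 1) * kMarkov k n n + kMarkov k n ((n : ℤ) - 1) := by
  obtain ⟨n, rfl⟩ := Nat.exists_eq_add_of_le' hn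
  push_cast
  rw [add_sub_cancel_right, kMarkov_row_one, kMarkov_row_zero,
    show (n : ℤ) + 1 + 1 = (n : ℤ) + 2 by ring, kMarkov_nearDiag, kMarkov_diag]
  obtain _ | n := n
  -- For `n = 1` the curves to `(0, 1)` and `(1, 0)` have empty posets, with one ideal each.
  · rw [Nat.cast_zero, kMarkov_zero_one, zero_add, zero_add, kMarkov_one_zero,
      halfForm_nearDiag_one]
    refine ⟨?_, rfl⟩
    simp only [halfForm, chainVec, rowVec]
    ring
  · push_cast
    rw [kMarkov_row_one, halfForm_row, show (n : ℤ) + 1 + 1 = (n : ℤ) + 2 by ring,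
      kMarkov_nearDiag]
    exact ⟨rfl, halfForm_nearDiag k n⟩
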